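/- **Setting.** A conic $\mathcal A y^2+2\mathcal B xy+\mathcal C x^2+2\mathcal D y+2\mathcal E x+\mathcal F=0$ with $\mathcal A\mathcal C\neq 0$ defines a lattice: points $x_s,y_s\in\mathbb C$ ($s\in\mathbb Z$) such that $y_s,y_{s+1}$ are the two $y$-roots at $x=x_s$ and $x_s,x_{s+1}$ are the two $x$-roots at $y=y_{s+1}$. The support $G$ and the $\mathbb D$-integral are of one of two kinds: (i) $G=\{x_s: s\in I\}$ with $I=\{0,\dots,\mathfrak N\}$, $\mathbb Z_{\ge 0}$ or $\mathbb Z$ and $\int_G \mathbb D x\,f(x)=\sum_{s\in I}(y_{s+1}-y_s)f(x_s)$ (absolutely convergent); (ii) $G=(-1,1)$ and $\int_G\mathbb D x\,f(x)=\frac{\sin\eta}{\eta}\int_{-1}^1 f(x)\,dx$ with $\sin\eta\ne0$. For a second conic (possibly of another type), let $v_\pm=\iota_\pm(u)$ be its two $y$-roots at $x=u$, put $\Delta v=v_+-v_-$, assume $\Delta v\neq0$ for $u\in J\subseteq\mathbb C$, and set $\mathbb D_uF(u)=\frac{F(v_+)-F(v_-)}{\Delta v}$, $\mathbb M_uF(u)=\tfrac12[F(v_+)+F(v_-)]$.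 Let $w(x;u)$ be a complex weight such that for all $u\in J$ and all $x$ in a set $\Omega\supseteq G$ $$R(x;u)\,\mathbb D_u w(x;u)=2S(x;u)\,\mathbb M_u w(x;u),$$ where $R(\cdot;u),S(\cdot;u)\in\mathbb C[x]$. Assume that for $v=v_\pm$ all moments $\int_G\mathbb D x\,w(x;v)x^k$ converge and that the orthonormal polynomials $p_n(\cdot;v)$ exist for $0\le n\le N$ ($N\in\mathbb N\cup\{\infty\}$): $\deg p_n=n$, $p_n$ is orthogonal to all polynomials of degree less than $n$, and $\int_G\mathbb D x\,w(x;v)p_n(x;v)^2=1$. Write $\gamma_n$ for the leading coefficient of $p_n$, $a_n=\gamma_{n-1}/\gamma_n$ for $n\ge1$, let $a_0(v)\neq0$ be arbitrary, and put $$f(x)=\int_G\mathbb D y\,\frac{w(y)}{x-y},\qquad q_n(x)=f(x)p_n(x)-\int_G\mathbb D y\,w(y)\frac{p_n(y)-p_n(x)}{y-x},\qquad p_{-1}=0,\quad q_{-1}=\frac1{a_0\gamma_0},$$ $$Y_n=\begin{pmatrix}p_n&q_n/w\\p_{n-1}&q_{n-1}/w\end{pmatrix}.$$ For non-zero constants $H_n(u)$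 define the deformation coefficients, at those $x\notin G$ where $f(x;v_+)$ and $f(x;v_-)$ converge absolutely, by $$\tfrac{2}{H_n}R_n=(R+\Delta vS)\left[-\tfrac1{a_n(v_-)}+p_{n-1}(v_+)q_n(v_-)-p_n(v_+)q_{n-1}(v_-)\right]+(R-\Delta vS)\left[-\tfrac1{a_n(v_+)}+p_{n-1}(v_-)q_n(v_+)-p_n(v_-)q_{n-1}(v_+)\right],$$ $$\tfrac{\Delta v}{H_n}\Gamma_n=(R+\Delta vS)\left[\tfrac1{a_n(v_-)}-p_{n-1}(v_+)q_n(v_-)-p_n(v_+)q_{n-1}(v_-)\right]+(R-\Delta vS)\left[-\tfrac1{a_n(v_+)}+p_{n-1}(v_-)q_n(v_+)+p_n(v_-)q_{n-1}(v_+)\right],$$ $$\tfrac{\Delta v}{H_n}\Xi_n=(R+\Delta vS)\left[\tfrac1{a_n(v_-)}+p_{n-1}(v_+)q_n(v_-)+p_n(v_+)q_{n-1}(v_-)\right]+(R-\Delta vS)\left[-\tfrac1{a_n(v_+)}-p_{n-1}(v_-)q_n(v_+)-p_n(v_-)q_{n-1}(v_+)\right],$$ $$\tfrac{\Delta v}{2H_n}\Phi_n=(R+\Delta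 vS)p_n(v_+)q_n(v_-)-(R-\Delta vS)p_n(v_-)q_n(v_+),$$ $$\tfrac{\Delta v}{2H_n}\Psi_n=-(R+\Delta vS)p_{n-1}(v_+)q_{n-1}(v_-)+(R-\Delta vS)p_{n-1}(v_-)q_{n-1}(v_+),$$ where $p_k(v_\pm)=p_k(x;v_\pm)$, $q_k(v_\pm)=q_k(x;v_\pm)$. **Claim.** For every $u\in J$ and every integer $0\le n\le N$: 1. $R_n,\Gamma_n,\Xi_n,\Phi_n,\Psi_n$ are polynomials in $x$. 2. For every $x\in\Omega\setminus G$ at which $f(x;v_\pm)$ converge absolutely and $w(x;v_\pm)\neq0$, $$R_n\,\mathbb D_uY_n=\begin{pmatrix}\Gamma_n&\Phi_n\\\Psi_n&\Xi_n\end{pmatrix}\mathbb M_uY_n,$$ and hence, wherever also $R_n(x;u)\neq0$, $$\mathbb D_uY_n=B_n\,\mathbb M_uY_n,\qquad B_n=\frac1{R_n}\begin{pmatrix}\Gamma_n&\Phi_n\\\Psi_n&\Xi_n\end{pmatrix}.$$ -/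

import Mathlib

open scoped Polynomial

noncomputable section

namespace SNUL

/-- The conic `𝒜 y² + 2 ℬ x y + 𝒞 x² + 2 𝒟 y + 2 ℰ x + ℱ = 0` (with `𝒜 𝒞 ≠ 0`) that defines a
non-uniform lattice of quadratic type. -/
structure Conic where
  (cA cB cC cD cE cF : ℂ)
  cA_ne : cA ≠ 0
  cC_ne : cC ≠ 0

/-- `K.YRoots x y₁ y₂`: the two `y`-roots of the conic at `x`, with multiplicity, are `y₁, y₂`. -/
def Conic.YRoots (K : Conic) (x y₁ y₂ : ℂ) : Prop :=
  y₁ + y₂ = -2 * (K.cB * x + K.cD) / K.cA ∧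
    y₁ * y₂ = (K.cC * x ^ 2 + 2 * K.cE * x + K.cF) / K.cA

/-- `K.XRoots y x₁ x₂`: the two `x`-roots of the conic at `y`, with multiplicity, are `x₁, x₂`. -/
def Conic.XRoots (K : Conic) (y x₁ x₂ : ℂ) : Prop :=
  x₁ + x₂ = -2 * (K.cB * y + K.cE) / K.cC ∧
    x₁ * x₂ = (K.cA * y ^ 2 + 2 * K.cD * y + K.cF) / K.cC

/-- A choice of the two root functions `ι₊, ι₋` of the conic. -/
structure Conic.Shifts (K : Conic) where
  plus : ℂ → ℂ
  minus : ℂ → ℂ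
  roots : ∀ u, K.YRoots u (plus u) (minus u)

/-- A direct lattice `x_s` together with its dual lattice `y_s`: `y_s = ι₋(x_s)` and
`y_{s+1} = ι₊(x_s)` are the `y`-roots at `x_s`, and `x_s, x_{s+1}` are the `x`-roots
at `y_{s+1}`. -/
structure Conic.Lattice (K : Conic) where
  x : ℤ → ℂ
  y : ℤ → ℂ
  yRoots : ∀ s, K.YRoots (x s) (y (s + 1)) (y s)
  xRoots : ∀ s, K.XRoots (y (s + 1)) (x s) (x (s + 1))

section Operators

variable {K : Conic} {E : Type*} [AddCommGroup E] [Module ℂ E]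

/-- The divided-difference operator `𝔻`. -/
def Conic.Shifts.DD (ι : K.Shifts) (F : ℂ → E) (u : ℂ) : E :=
  (ι.plus u - ι.minus u)⁻¹ • (F (ι.plus u) - F (ι.minus u))

/-- The mean operator `𝕄`. -/
def Conic.Shifts.MM (ι : K.Shifts) (F : ℂ → E) (u : ℂ) : E :=
  (2⁻¹ : ℂ) • (F (ι.plus u) + F (ι.minus u))

end Operators

/-- The two kinds of support of a weight, each with its `𝔻`-integral: the points of a lattice with
indices in `{0, …, 𝔑}`, `ℤ_{≥ 0}` or `ℤ`, with `∫ 𝔻x f = ∑ Δy(x_s) f(x_s)`; and the interval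
`(-1, 1)` for the `q`-quadratic lattice, `q = exp (2iη)`, with
`∫ 𝔻x f = (sin η / η) ∫_{-1}^{1} f(x) dx`. -/
inductive Support
  | lattice (K : Conic) (L : K.Lattice) (I : Set ℤ)
      (hI : (∃ m : ℕ, I = Set.Icc 0 (m : ℤ)) ∨ I = Set.Ici 0 ∨ I = Set.univ) : Support
  | interval (η : ℂ) (hη : Complex.sin η ≠ 0) : Support

namespace Support

/-- The support as a subset of the complex plane. -/
def carrier : Support → Set ℂ
  | lattice _ L I _ => L.x '' I
  | interval _ _ => Complex.ofReal '' Set.Ioo (-1) 1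

/-- (Absolute) convergence of the `𝔻`-integral. -/
def Converges : Support → (ℂ → ℂ) → Prop
  | lattice _ L I _, f => Summable fun s : I => (L.y (s + 1) - L.y s) * f (L.x s)
  | interval _ _, f =>
      MeasureTheory.IntegrableOn (fun t : ℝ => f (t : ℂ)) (Set.Ioo (-1) 1)

/-- The `𝔻`-integral. -/
def integral : Support → (ℂ → ℂ) → ℂ
  | lattice _ L I _, f => ∑' s : I, (L.y (s + 1) - L.y s) * f (L.x s)
  | interval η _, f => Complex.sin η / η * ∫ t in Set.Ioo (-1 : ℝ) 1, f (t : ℂ)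

end Support

/-- `p 0, p 1, …` is the orthonormal polynomial system of the (complex) weight `ω` up to degree
`N` (`N = ⊤`: all degrees; on a lattice of `𝔑 + 1` points at most `N = 𝔑` can occur).
Orthogonality to a basis `l_m`, `m < n`, with `l_m` of exact degree `m`, is orthogonality to all
polynomials of degree `< n`. -/
structure IsOPS (G : Support) (ω : ℂ → ℂ) (N : ℕ∞) (p : ℕ → ℂ[X]) : Prop where
  moments : ∀ g : ℂ[X], G.Converges fun y => ω y * g.eval y
  degree_eq : ∀ n : ℕ, (n : ℕ∞) ≤ N → (p n).degree = n
  orthogonal : ∀ n : ℕ, (n : ℕ∞) ≤ N → ∀ g : ℂ[X], g.degree < n →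
    G.integral (fun y => ω y * (p n).eval y * g.eval y) = 0
  normalized : ∀ n : ℕ, (n : ℕ∞) ≤ N → G.integral (fun y => ω y * (p n).eval y ^ 2) = 1

/-- The Stieltjes function `f(x) = ∫ 𝔻y ω(y)/(x - y)`, `x ∉ G`. -/
def stieltjes (G : Support) (ω : ℂ → ℂ) (x : ℂ) : ℂ :=
  G.integral fun y => ω y / (x - y)

/-- `∫ 𝔻y ω(y) (P(y) - P(x))/(y - x)`; the difference quotient is the quotient polynomial of
`P` by `X - x`, evaluated at `y`. -/
def associated (G : Support) (ω : ℂ → ℂ) (P : ℂ[X]) (x : ℂ) : ℂ :=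
  G.integral fun y => ω y * (P /ₘ (Polynomial.X - Polynomial.C x)).eval y

/-- The function of the second kind `f P - P⁽¹⁾`. -/
def secondKind (G : Support) (ω : ℂ → ℂ) (P : ℂ[X]) (x : ℂ) : ℂ :=
  stieltjes G ω x * P.eval x - associated G ω P x

/-- The data of a deformation: the support, the weight `w x u`, the polynomials `p_n(·; u)`, the
free constant `a_0(u)`, the deformation lattice, the deformation data polynomials
`R(·; u)`, `S(·; u)` and the decoupling factors `H_n(u)`. -/
structure Deformation where
  G : Support
  w : ℂ → ℂ → ℂ
  p : ℕ → ℂ → ℂ[X]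
  a₀ : ℂ → ℂ
  K : Conic
  ι : K.Shifts
  R : ℂ → ℂ[X]
  S : ℂ → ℂ[X]
  H : ℕ → ℂ → ℂ

namespace Deformation

variable (𝒟 : Deformation)

/-- `Δv = v₊ - v₋`. -/
def Δv (u : ℂ) : ℂ := 𝒟.ι.plus u - 𝒟.ι.minus u

/-- `p_n(x; v)`. -/
def P (n : ℕ) (x v : ℂ) : ℂ := (𝒟.p n v).eval x

/-- `p_{n-1}(x; v)`, with `p_{-1} = 0`. -/
def Pprev : ℕ → ℂ → ℂ → ℂ
  | 0, _, _ => 0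
  | n + 1, x, v => 𝒟.P n x v

/-- The leading coefficient `γ_n(v)`. -/
def γ (n : ℕ) (v : ℂ) : ℂ := (𝒟.p n v).leadingCoeff

/-- `a_n(v) = γ_{n-1}(v) / γ_n(v)` for `n ≥ 1`. -/
def a : ℕ → ℂ → ℂ
  | 0, v => 𝒟.a₀ v
  | n + 1, v => 𝒟.γ n v / 𝒟.γ (n + 1) v

/-- `q_n(x; v)`. -/
def Q (n : ℕ) (x v : ℂ) : ℂ := secondKind 𝒟.G (fun y => 𝒟.w y v) (𝒟.p n v) x

/-- `q_{n-1}(x; v)`, with `q_{-1} = 1 / (a_0 γ_0)`. -/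
def Qprev : ℕ → ℂ → ℂ → ℂ
  | 0, _, v => 1 / (𝒟.a₀ v * 𝒟.γ 0 v)
  | n + 1, x, v => 𝒟.Q n x v

/-- The matrix `Y_n(x; v)`. -/
def Y (n : ℕ) (x v : ℂ) : Matrix (Fin 2) (Fin 2) ℂ :=
  !![𝒟.P n x v, 𝒟.Q n x v / 𝒟.w x v; 𝒟.Pprev n x v, 𝒟.Qprev n x v / 𝒟.w x v]

/-- `(R + Δv S)(x; u)`. -/
def Rplus (x u : ℂ) : ℂ := (𝒟.R u).eval x + 𝒟.Δv u * (𝒟.S u).eval x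

/-- `(R - Δv S)(x; u)`. -/
def Rminus (x u : ℂ) : ℂ := (𝒟.R u).eval x - 𝒟.Δv u * (𝒟.S u).eval x

/-- The deformation coefficient `R_n(x; u)`. -/
def coeffR (n : ℕ) (x u : ℂ) : ℂ :=
  let vp := 𝒟.ι.plus u
  let vm := 𝒟.ι.minus u
  𝒟.H n u / 2 *
    (𝒟.Rplus x u *
        (-(1 / 𝒟.a n vm) + 𝒟.Pprev n x vp * 𝒟.Q n x vm - 𝒟.P n x vp * 𝒟.Qprev n x vm) +
      𝒟.Rminus x u *
        (-(1 / 𝒟.a n vp) + 𝒟.Pprev n x vm * 𝒟.Q n x vp - 𝒟.P n x vm * 𝒟.Qprev n x vp))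

/-- The deformation coefficient `Γ_n(x; u)`. -/
def coeffΓ (n : ℕ) (x u : ℂ) : ℂ :=
  let vp := 𝒟.ι.plus u
  let vm := 𝒟.ι.minus u
  𝒟.H n u / 𝒟.Δv u *
    (𝒟.Rplus x u *
        (1 / 𝒟.a n vm - 𝒟.Pprev n x vp * 𝒟.Q n x vm - 𝒟.P n x vp * 𝒟.Qprev n x vm) +
      𝒟.Rminus x u *
        (-(1 / 𝒟.a n vp) + 𝒟.Pprev n x vm * 𝒟.Q n x vp + 𝒟.P n x vm * 𝒟.Qprev n x vp))

/-- The deformation coefficient `Ξ_n(x; u)`. -/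
def coeffΞ (n : ℕ) (x u : ℂ) : ℂ :=
  let vp := 𝒟.ι.plus u
  let vm := 𝒟.ι.minus u
  𝒟.H n u / 𝒟.Δv u *
    (𝒟.Rplus x u *
        (1 / 𝒟.a n vm + 𝒟.Pprev n x vp * 𝒟.Q n x vm + 𝒟.P n x vp * 𝒟.Qprev n x vm) +
      𝒟.Rminus x u *
        (-(1 / 𝒟.a n vp) - 𝒟.Pprev n x vm * 𝒟.Q n x vp - 𝒟.P n x vm * 𝒟.Qprev n x vp))

/-- The deformation coefficient `Φ_n(x; u)`. -/
def coeffΦ (n : ℕ) (x u : ℂ) : ℂ :=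
  let vp := 𝒟.ι.plus u
  let vm := 𝒟.ι.minus u
  2 * 𝒟.H n u / 𝒟.Δv u *
    (𝒟.Rplus x u * 𝒟.P n x vp * 𝒟.Q n x vm - 𝒟.Rminus x u * 𝒟.P n x vm * 𝒟.Q n x vp)

/-- The deformation coefficient `Ψ_n(x; u)`. -/
def coeffΨ (n : ℕ) (x u : ℂ) : ℂ :=
  let vp := 𝒟.ι.plus u
  let vm := 𝒟.ι.minus u
  2 * 𝒟.H n u / 𝒟.Δv u *
    (-(𝒟.Rplus x u * 𝒟.Pprev n x vp * 𝒟.Qprev n x vm) +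
      𝒟.Rminus x u * 𝒟.Pprev n x vm * 𝒟.Qprev n x vp)

/-- The matrix `[[Γ_n, Φ_n], [Ψ_n, Ξ_n]]`. -/
def numB (n : ℕ) (x u : ℂ) : Matrix (Fin 2) (Fin 2) ℂ :=
  !![𝒟.coeffΓ n x u, 𝒟.coeffΦ n x u; 𝒟.coeffΨ n x u, 𝒟.coeffΞ n x u]

/-- The deformation matrix `B_n = R_n⁻¹ [[Γ_n, Φ_n], [Ψ_n, Ξ_n]]` (meaningful where
`R_n(x; u) ≠ 0`). -/
def B (n : ℕ) (x u : ℂ) : Matrix (Fin 2) (Fin 2) ℂ := (𝒟.coeffR n x u)⁻¹ • 𝒟.numB n x u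

/-- The points `x ∉ G` at which both Stieltjes functions `f(x; v₊)` and `f(x; v₋)` converge;
all points off the closure of `G` are of this kind once the zeroth moments converge. -/
def regularPoints (u : ℂ) : Set ℂ :=
  {x | x ∉ 𝒟.G.carrier ∧
    𝒟.G.Converges (fun y => 𝒟.w y (𝒟.ι.plus u) / (x - y)) ∧
    𝒟.G.Converges (fun y => 𝒟.w y (𝒟.ι.minus u) / (x - y))}

/-- On the set `J` of deformation variables and the domain `Ω ⊇ G` of the spectral variable, `w` is
a weight with `R 𝔻_u w = 2 S 𝕄_u w` whose orthonormal polynomials at `v₊` and `v₋` exist up to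
degree `N`. -/
structure IsSemiClassical (J Ω : Set ℂ) (N : ℕ∞) : Prop where
  carrier_subset : 𝒟.G.carrier ⊆ Ω
  Δv_ne : ∀ u ∈ J, 𝒟.Δv u ≠ 0
  pearson : ∀ u ∈ J, ∀ x ∈ Ω,
    (𝒟.R u).eval x * 𝒟.ι.DD (𝒟.w x) u = 2 * (𝒟.S u).eval x * 𝒟.ι.MM (𝒟.w x) u
  ops_plus : ∀ u ∈ J,
    IsOPS 𝒟.G (fun y => 𝒟.w y (𝒟.ι.plus u)) N (fun n => 𝒟.p n (𝒟.ι.plus u))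
  ops_minus : ∀ u ∈ J,
    IsOPS 𝒟.G (fun y => 𝒟.w y (𝒟.ι.minus u)) N (fun n => 𝒟.p n (𝒟.ι.minus u))
  a₀_plus_ne : ∀ u ∈ J, 𝒟.a₀ (𝒟.ι.plus u) ≠ 0
  a₀_minus_ne : ∀ u ∈ J, 𝒟.a₀ (𝒟.ι.minus u) ≠ 0
  H_ne : ∀ n, ∀ u ∈ J, 𝒟.H n u ≠ 0

end Deformation

/-- `g` is given on `D` by a polynomial. -/
def IsPolynomialOn (D : Set ℂ) (g : ℂ → ℂ) : Prop :=
  ∃ P : ℂ[X], ∀ x ∈ D, g x = P.eval x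

end SNUL

end

/-! Polynomiality. The deformation equation for `w` is equivalent to $(R+\Delta v
S)\,w(v_-)=(R-\Delta v S)\,w(v_+)$ (`Rplus_mul_eq`). A product $P(x)q(x)$ of a polynomial and a
function of the second kind is the Stieltjes transform of a weight times polynomials, plus an
associated polynomial (`eval_mul_secondKind`). In the combinations that build the coefficients, the
relation on $G$ makes the two transforms cancel, so only polynomials remain
(`isPolynomialOn_cross`).

Matrix equation. Write $Y_\pm=Y_n(x;v_\pm)$, $w_\pm=w(x;v_\pm)$, $R\pm\Delta v S=t\,w_\pm$. The
Casoratian (`one_div_a`) gives $\det Y_\pm=1/(a_n(v_\pm)w_\pm)$. Hence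
$R_n=-\tfrac{H_n}{2}t\,w_+w_-\det(Y_++Y_-)$, and the numerator matrix is $-\tfrac{H_n}{\Delta
v}t\,w_+w_-(Y_+-Y_-)\,\mathrm{adj}(Y_++Y_-)$. The claim is then $\mathrm{adj}(M)\,M=\det(M)\,1$ for
$M=Y_++Y_-$. -/

open Polynomial

namespace SNUL

/-! ### Linearity of the $\mathbb D$-integral -/

namespace Support

variable {G : Support} {f g : ℂ → ℂ}

theorem Converges.congr (hf : G.Converges f) (h : Set.EqOn f g G.carrier) : G.Converges g := by
  cases G with
  | lattice K L I hI =>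
    refine Summable.congr hf fun s => ?_
    rw [h (Set.mem_image_of_mem L.x s.2)]
  | interval η hη =>
    exact MeasureTheory.IntegrableOn.congr_fun hf
      (fun t ht => h (Set.mem_image_of_mem Complex.ofReal ht)) measurableSet_Ioo

theorem Converges.add (hf : G.Converges f) (hg : G.Converges g) :
    G.Converges fun y => f y + g y := by
  cases G with
  | lattice K L I hI =>
    exact (Summable.add hf hg).congr fun s => by ring
  | interval η hη => exact MeasureTheory.Integrable.add hf hg

theorem Converges.const_mul (c : ℂ) (hf : G.Converges f) : G.Converges fun y => c * f y := by
  cases G with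
  | lattice K L I hI =>
    exact (Summable.mul_left c hf).congr fun s => by ring
  | interval η hη => exact MeasureTheory.Integrable.const_mul hf c

theorem integral_congr (h : Set.EqOn f g G.carrier) : G.integral f = G.integral g := by
  cases G with
  | lattice K L I hI =>
    refine tsum_congr fun s => ?_
    rw [h (Set.mem_image_of_mem L.x s.2)]
  | interval η hη =>
    refine congrArg (Complex.sin η / η * ·) ?_
    exact MeasureTheory.setIntegral_congr_fun measurableSet_Ioo
      fun t ht => h (Set.mem_image_of_mem Complex.ofReal ht)

theorem integral_add (hf : G.Converges f) (hg : G.Converges g) :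
    G.integral (fun y => f y + g y) = G.integral f + G.integral g := by
  cases G with
  | lattice K L I hI =>
    exact (tsum_congr fun s => by ring).trans (Summable.tsum_add hf hg)
  | interval η hη =>
    simp only [integral]
    rw [MeasureTheory.integral_add hf hg, mul_add]

/-- Convergence is not needed: a divergent sum or integral has the value 0, and a non-zero scalar
preserves divergence. -/
theorem integral_const_mul (c : ℂ) (f : ℂ → ℂ) :
    G.integral (fun y => c * f y) = c * G.integral f := by
  cases G with
  | lattice K L I hI =>
    exact (tsum_congr fun s => by ring).trans tsum_mul_left
  | interval η hη =>
    simp only [integral]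
    rw [MeasureTheory.integral_const_mul]
    ring

theorem integral_zero : G.integral (fun _ => 0) = 0 := by
  simpa using integral_const_mul (G := G) 0 fun _ => 0

end Support

/-- Division with remainder by `X - x`, evaluated at `y`. -/
theorem eval_eq_mul_divByMonic_add (P : ℂ[X]) (x y : ℂ) :
    P.eval y = (y - x) * (P /ₘ (X - C x)).eval y + P.eval x := by
  have h := congrArg (eval y) (modByMonic_add_div P (X - C x))
  rw [modByMonic_X_sub_C_eq_C_eval] at h
  simp only [eval_add, eval_mul, eval_sub, eval_X, eval_C] at h
  rw [← h]
  ring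

/-- From $yP(y)-xP(x)=(y-x)P(y)+x(P(y)-P(x))$; this drives the induction on degree for associated
polynomials. -/
theorem eval_divByMonic_mul_X (P : ℂ[X]) (x y : ℂ) :
    ((P * X) /ₘ (X - C x)).eval y = P.eval y + x * (P /ₘ (X - C x)).eval y := by
  have h : (P * X) /ₘ (X - C x) = P + C x * (P /ₘ (X - C x)) := by
    refine (div_modByMonic_unique _ (C (x * P.eval x)) (monic_X_sub_C x) ⟨?_, ?_⟩).1
    · have h := modByMonic_add_div P (X - C x)
      rw [modByMonic_X_sub_C_eq_C_eval] at h
      rw [C_mul]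
      linear_combination (C x) * h
    · rw [degree_X_sub_C]
      exact degree_C_le.trans_lt (by norm_num)
  simp [h]

theorem eval_add_divByMonic (P Q : ℂ[X]) (x y : ℂ) :
    ((P + Q) /ₘ (X - C x)).eval y = (P /ₘ (X - C x)).eval y + (Q /ₘ (X - C x)).eval y := by
  have h : (P + Q) /ₘ (X - C x) = P /ₘ (X - C x) + Q /ₘ (X - C x) := by
    refine (div_modByMonic_unique _ (C (P.eval x + Q.eval x)) (monic_X_sub_C x) ⟨?_, ?_⟩).1
    · have hP := modByMonic_add_div P (X - C x)
      have hQ := modByMonic_add_div Q (X - C x)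
      rw [modByMonic_X_sub_C_eq_C_eval] at hP hQ
      rw [C_add]
      linear_combination hP + hQ
    · rw [degree_X_sub_C]
      exact degree_C_le.trans_lt (by norm_num)
  rw [h, eval_add]

/-! ### Associated polynomials and functions of the second kind -/

section Moments

variable {G : Support} {ω : ℂ → ℂ}

theorem isPolynomialOn_associated
    (hω : ∀ g : ℂ[X], G.Converges fun y => ω y * g.eval y) (P : ℂ[X]) :
    IsPolynomialOn Set.univ (associated G ω P) := by
  induction P using Polynomial.induction_on with
  | C a =>
    refine ⟨0, fun x _ => ?_⟩
    have : (C a : ℂ[X]) /ₘ (X - C x) = 0 := by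
      rw [divByMonic_eq_zero_iff (monic_X_sub_C x), degree_X_sub_C]
      exact degree_C_le.trans_lt (by norm_num)
    simp [associated, this, Support.integral_zero]
  | add p q hp hq =>
    obtain ⟨A, hA⟩ := hp
    obtain ⟨B, hB⟩ := hq
    refine ⟨A + B, fun x hx => ?_⟩
    rw [eval_add, ← hA x hx, ← hB x hx]
    simp only [associated]
    rw [← Support.integral_add (hω _) (hω _)]
    congr 1
    ext y
    rw [eval_add_divByMonic, mul_add]
  | monomial n a h =>
    obtain ⟨A, hA⟩ := h
    -- The recursion for difference quotients: multiplying by `X` adds a moment and multiplies the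
    -- previous associated polynomial by $x$.
    refine ⟨C (G.integral fun y => ω y * (C a * X ^ n).eval y) + X * A, fun x hx => ?_⟩
    rw [eval_add, eval_mul, eval_C, eval_X, ← hA x hx, pow_succ, ← mul_assoc]
    simp only [associated]
    rw [← Support.integral_const_mul, ← Support.integral_add (hω _) ((hω _).const_mul x)]
    congr 1
    ext y
    rw [eval_divByMonic_mul_X]
    ring

theorem moments_mul_eval (hω : ∀ g : ℂ[X], G.Converges fun y => ω y * g.eval y) (P : ℂ[X]) :
    ∀ g : ℂ[X], G.Converges fun y => ω y * P.eval y * g.eval y := fun g =>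
  (hω (P * g)).congr fun y _ => by simp only [eval_mul]; ring

variable {x : ℂ}

theorem div_sub_mul_eval_eq (hx : x ∉ G.carrier) (P : ℂ[X]) :
    Set.EqOn (fun y => P.eval x * (ω y / (x - y)) + -1 * (ω y * (P /ₘ (X - C x)).eval y))
      (fun y => ω y * P.eval y / (x - y)) G.carrier := by
  intro y hy
  have hxy : x - y ≠ 0 := sub_ne_zero.2 fun h => hx (h ▸ hy)
  simp only
  rw [eval_eq_mul_divByMonic_add P x y]
  field_simp
  ring

theorem converges_mul_eval_div (hω : ∀ g : ℂ[X], G.Converges fun y => ω y * g.eval y)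
    (hx : x ∉ G.carrier) (hc : G.Converges fun y => ω y / (x - y)) (P : ℂ[X]) :
    G.Converges fun y => ω y * P.eval y / (x - y) :=
  ((hc.const_mul _).add ((hω _).const_mul _)).congr (div_sub_mul_eval_eq hx P)

/-- The function of the second kind of `P` is the Stieltjes transform of `ω P`. -/
theorem secondKind_eq_stieltjes (hω : ∀ g : ℂ[X], G.Converges fun y => ω y * g.eval y)
    (hx : x ∉ G.carrier) (hc : G.Converges fun y => ω y / (x - y)) (P : ℂ[X]) :
    secondKind G ω P x = stieltjes G (fun y => ω y * P.eval y) x := by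
  rw [secondKind, stieltjes, stieltjes, associated,
    ← Support.integral_congr (div_sub_mul_eval_eq hx P),
    Support.integral_add (hc.const_mul _) ((hω _).const_mul _),
    Support.integral_const_mul, Support.integral_const_mul]
  ring

/-- The weight $\omega Q$ again has convergent moments, so $P$ can be absorbed into its Stieltjes
transform at the cost of an associated polynomial. -/
theorem eval_mul_secondKind (hω : ∀ g : ℂ[X], G.Converges fun y => ω y * g.eval y)
    (hx : x ∉ G.carrier) (hc : G.Converges fun y => ω y / (x - y)) (P Q : ℂ[X]) :
    P.eval x * secondKind G ω Q x =
      stieltjes G (fun y => ω y * Q.eval y * P.eval y) x +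
        associated G (fun y => ω y * Q.eval y) P x := by
  have h := secondKind_eq_stieltjes (moments_mul_eval hω Q) hx
    (converges_mul_eval_div hω hx hc Q) P
  rw [secondKind_eq_stieltjes hω hx hc Q, ← h, secondKind]
  ring

end Moments

/-- If `A(y) ω₁(y) = B(y) ω₂(y)` on the support, then
`A P q₁ - B Q q₂` is a polynomial, where `q₁` and `q₂` are the functions of the second kind of
`Q` with respect to `ω₁` and of `P` with respect to `ω₂`. -/
theorem isPolynomialOn_cross {G : Support} {ω₁ ω₂ : ℂ → ℂ}
    (h₁ : ∀ g : ℂ[X], G.Converges fun y => ω₁ y * g.eval y)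
    (h₂ : ∀ g : ℂ[X], G.Converges fun y => ω₂ y * g.eval y) {A B : ℂ[X]}
    (hAB : ∀ y ∈ G.carrier, A.eval y * ω₁ y = B.eval y * ω₂ y) (P Q : ℂ[X]) :
    IsPolynomialOn {x | x ∉ G.carrier ∧ G.Converges (fun y => ω₂ y / (x - y)) ∧
        G.Converges (fun y => ω₁ y / (x - y))}
      (fun x => A.eval x * P.eval x * secondKind G ω₁ Q x -
        B.eval x * Q.eval x * secondKind G ω₂ P x) := by
  obtain ⟨U, hU⟩ := isPolynomialOn_associated (moments_mul_eval h₁ Q) (A * P)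
  obtain ⟨V, hV⟩ := isPolynomialOn_associated (moments_mul_eval h₂ P) (B * Q)
  refine ⟨U - V, fun x ⟨hx, hc₂, hc₁⟩ => ?_⟩
  simp only
  rw [← eval_mul, ← eval_mul, eval_mul_secondKind h₁ hx hc₁, eval_mul_secondKind h₂ hx hc₂,
    eval_sub, ← hU x trivial, ← hV x trivial]
  -- The non-polynomial parts agree because the integrands coincide on the support.
  have : stieltjes G (fun y => ω₁ y * Q.eval y * (A * P).eval y) x =
      stieltjes G (fun y => ω₂ y * P.eval y * (B * Q).eval y) x := by
    refine Support.integral_congr fun y hy => ?_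
    simp only [eval_mul]
    congr 1
    linear_combination Q.eval y * P.eval y * hAB y hy
  rw [this]
  ring

theorem IsPolynomialOn.add {D : Set ℂ} {f g : ℂ → ℂ} (hf : IsPolynomialOn D f)
    (hg : IsPolynomialOn D g) : IsPolynomialOn D fun x => f x + g x := by
  obtain ⟨A, hA⟩ := hf
  obtain ⟨B, hB⟩ := hg
  exact ⟨A + B, fun x hx => by simp only [hA x hx, hB x hx, eval_add]⟩

theorem IsPolynomialOn.const_mul {D : Set ℂ} {f : ℂ → ℂ} (c : ℂ) (hf : IsPolynomialOn D f) :
    IsPolynomialOn D fun x => c * f x := by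
  obtain ⟨A, hA⟩ := hf
  exact ⟨C c * A, fun x hx => by simp only [hA x hx, eval_mul, eval_C]⟩

theorem IsPolynomialOn.congr {D : Set ℂ} {f g : ℂ → ℂ} (hf : IsPolynomialOn D f)
    (h : ∀ x ∈ D, g x = f x) : IsPolynomialOn D g := by
  obtain ⟨A, hA⟩ := hf
  exact ⟨A, fun x hx => (h x hx).trans (hA x hx)⟩

/-! ### Orthonormal polynomials and their Casoratian -/

namespace IsOPS

variable {G : Support} {ω : ℂ → ℂ} {N : ℕ∞} {p : ℕ → ℂ[X]}

theorem ne_zero (h : IsOPS G ω N p) {n : ℕ} (hn : (n : ℕ∞) ≤ N) : p n ≠ 0 := by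
  intro h0
  have := h.degree_eq n hn
  simp [h0] at this

/-- Integrating against `p n` a polynomial of degree at most `n` extracts its coefficient of
degree `n`, divided by the leading coefficient of `p n`. -/
theorem integral_mul_eq (h : IsOPS G ω N p) {n : ℕ} (hn : (n : ℕ∞) ≤ N) {g : ℂ[X]}
    (hg : g.natDegree ≤ n) :
    G.integral (fun y => ω y * (p n).eval y * g.eval y) =
      g.coeff n / (p n).leadingCoeff := by
  have hd : (p n).natDegree = n := natDegree_eq_of_degree_eq_some (h.degree_eq n hn)
  have hl : (p n).leadingCoeff ≠ 0 := leadingCoeff_ne_zero.2 (h.ne_zero hn)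
  set c := g.coeff n / (p n).leadingCoeff with hc
  have hr : (g - C c * p n).degree < n := by
    refine (degree_lt_iff_coeff_zero _ _).2 fun m hm => ?_
    rcases hm.eq_or_lt with rfl | hlt
    · have : (p n).coeff n = (p n).leadingCoeff := by rw [leadingCoeff, hd]
      rw [coeff_sub, coeff_C_mul, this, hc, div_mul_cancel₀ _ hl, sub_self]
    · rw [coeff_sub, coeff_C_mul, coeff_eq_zero_of_natDegree_lt (hg.trans_lt hlt),
        coeff_eq_zero_of_natDegree_lt (hd.trans_lt hlt), mul_zero, sub_zero]
  have h2 : G.Converges fun y => ω y * (p n).eval y ^ 2 :=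
    (h.moments (p n ^ 2)).congr fun y _ => by simp
  have key := Support.integral_add (h2.const_mul c) (moments_mul_eval h.moments (p n) _)
    (g := fun y => ω y * (p n).eval y * (g - C c * p n).eval y)
  rw [Support.integral_const_mul, h.normalized n hn, h.orthogonal n hn _ hr, mul_one,
    add_zero] at key
  rw [← key]
  congr 1
  ext y
  simp only [eval_sub, eval_mul, eval_C]
  ring

/-- The Casoratian of the polynomials and their functions of the second kind. -/
theorem casoratian (h : IsOPS G ω N p) {n : ℕ} (hn : ((n + 1 : ℕ) : ℕ∞) ≤ N) {x : ℂ}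
    (hx : x ∉ G.carrier) (hc : G.Converges fun y => ω y / (x - y)) :
    (p (n + 1)).eval x * secondKind G ω (p n) x - (p n).eval x * secondKind G ω (p (n + 1)) x =
      (p (n + 1)).leadingCoeff / (p n).leadingCoeff := by
  have hn' : (n : ℕ∞) ≤ N := le_trans (by exact_mod_cast n.le_succ) hn
  have hd : (p n).natDegree = n := natDegree_eq_of_degree_eq_some (h.degree_eq n hn')
  have hd' : (p (n + 1)).natDegree = n + 1 :=
    natDegree_eq_of_degree_eq_some (h.degree_eq (n + 1) hn)
  have hq : (p (n + 1) /ₘ (X - C x)).natDegree = n := by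
    rw [natDegree_divByMonic _ (monic_X_sub_C x), hd', natDegree_X_sub_C, Nat.add_sub_cancel]
  have hlc : (p (n + 1) /ₘ (X - C x)).coeff n = (p (n + 1)).leadingCoeff := by
    have : (p (n + 1) /ₘ (X - C x)).coeff n = (p (n + 1) /ₘ (X - C x)).leadingCoeff := by
      rw [leadingCoeff, hq]
    rw [this]
    refine leadingCoeff_divByMonic_X_sub_C _ ?_ x
    rw [h.degree_eq (n + 1) hn]
    exact_mod_cast Nat.succ_ne_zero n
  have hlow : (p n /ₘ (X - C x)).degree < ((n + 1 : ℕ) : WithBot ℕ) := by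
    refine (degree_divByMonic_le _ _).trans_lt ?_
    rw [h.degree_eq n hn']
    exact_mod_cast n.lt_succ_self
  -- Both products have the Stieltjes transform of $\omega p_np_{n+1}$ as non-polynomial part, so
  -- only the associated terms matter. Here the difference quotient has too low a degree; in `h1` it
  -- has degree `n` and leading coefficient $\gamma_{n+1}$.
  have h0 : associated G (fun y => ω y * (p (n + 1)).eval y) (p n) x = 0 :=
    h.orthogonal (n + 1) hn _ hlow
  have h1 : associated G (fun y => ω y * (p n).eval y) (p (n + 1)) x =
      (p (n + 1)).leadingCoeff / (p n).leadingCoeff := by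
    rw [← hlc]
    exact h.integral_mul_eq hn' hq.le
  rw [eval_mul_secondKind h.moments hx hc, eval_mul_secondKind h.moments hx hc, h0, h1]
  simp only [mul_right_comm]
  ring

end IsOPS

/-! ### Polynomiality of the coefficients and the matrix equation -/

namespace Deformation

variable (𝒟 : Deformation)

/-- For $n=0$ the conventions for $p_{-1}$ and $q_{-1}$ are exactly what extends the Casoratian. -/
theorem one_div_a {v : ℂ} {N : ℕ∞} (h : IsOPS 𝒟.G (fun y => 𝒟.w y v) N fun n => 𝒟.p n v)
    {n : ℕ} (hn : (n : ℕ∞) ≤ N) {x : ℂ} (hx : x ∉ 𝒟.G.carrier)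
    (hc : 𝒟.G.Converges fun y => 𝒟.w y v / (x - y)) :
    1 / 𝒟.a n v = 𝒟.P n x v * 𝒟.Qprev n x v - 𝒟.Pprev n x v * 𝒟.Q n x v := by
  cases n with
  | zero =>
    have hd : (𝒟.p 0 v).degree = ((0 : ℕ) : WithBot ℕ) := h.degree_eq 0 hn
    have hP : 𝒟.p 0 v = C ((𝒟.p 0 v).coeff 0) := eq_C_of_degree_eq_zero hd
    have hP' : 𝒟.P 0 x v = 𝒟.γ 0 v := by
      rw [P, γ, hP, eval_C, leadingCoeff_C]
    have hγ : 𝒟.γ 0 v ≠ 0 := leadingCoeff_ne_zero.2 (h.ne_zero hn)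
    rw [hP']
    simp only [a, Qprev, Pprev]
    rw [zero_mul, sub_zero, mul_one_div, div_mul_cancel_right₀ hγ, one_div]
  | succ n =>
    simp only [a, Qprev, Pprev, P, Q, γ, one_div_div]
    exact (h.casoratian hn hx hc).symm

theorem Rplus_mul_eq {u x : ℂ} (hΔ : 𝒟.Δv u ≠ 0)
    (h : (𝒟.R u).eval x * 𝒟.ι.DD (𝒟.w x) u = 2 * (𝒟.S u).eval x * 𝒟.ι.MM (𝒟.w x) u) :
    𝒟.Rplus x u * 𝒟.w x (𝒟.ι.minus u) = 𝒟.Rminus x u * 𝒟.w x (𝒟.ι.plus u) := by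
  simp only [Conic.Shifts.DD, Conic.Shifts.MM, smul_eq_mul] at h
  change _ * ((𝒟.Δv u)⁻¹ * _) = _ at h
  field_simp at h
  rw [Rplus, Rminus]
  linear_combination -h

variable {𝒟} {J Ω : Set ℂ} {N : ℕ∞} {u : ℂ}

theorem isPolynomialOn_Rplus (𝒟 : Deformation) (u : ℂ) (D : Set ℂ) :
    IsPolynomialOn D fun x => 𝒟.Rplus x u :=
  ⟨𝒟.R u + C (𝒟.Δv u) * 𝒟.S u, fun x _ => by simp [Rplus]⟩

theorem isPolynomialOn_Rminus (𝒟 : Deformation) (u : ℂ) (D : Set ℂ) :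
    IsPolynomialOn D fun x => 𝒟.Rminus x u :=
  ⟨𝒟.R u - C (𝒟.Δv u) * 𝒟.S u, fun x _ => by simp [Rminus]⟩

theorem IsSemiClassical.isPolynomialOn_P_P (h : 𝒟.IsSemiClassical J Ω N) (hu : u ∈ J) (m k : ℕ) :
    IsPolynomialOn (𝒟.regularPoints u) fun x =>
      𝒟.Rplus x u * 𝒟.P m x (𝒟.ι.plus u) * 𝒟.Q k x (𝒟.ι.minus u) -
        𝒟.Rminus x u * 𝒟.P k x (𝒟.ι.minus u) * 𝒟.Q m x (𝒟.ι.plus u) := by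
  have hR : ∀ x, 𝒟.Rplus x u = (𝒟.R u + C (𝒟.Δv u) * 𝒟.S u).eval x := fun x => by simp [Rplus]
  have hR' : ∀ x, 𝒟.Rminus x u = (𝒟.R u - C (𝒟.Δv u) * 𝒟.S u).eval x := fun x => by
    simp [Rminus]
  simp only [hR, hR']
  -- Here $\omega_1=w(\cdot;v_-)$ goes with $A=R+\Delta vS$, and $\omega_2=w(\cdot;v_+)$ with
  -- $B=R-\Delta vS$.
  refine isPolynomialOn_cross (h.ops_minus u hu).moments (h.ops_plus u hu).moments
    (fun y hy => ?_) (𝒟.p m (𝒟.ι.plus u)) (𝒟.p k (𝒟.ι.minus u))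
  rw [← hR, ← hR']
  exact 𝒟.Rplus_mul_eq (h.Δv_ne u hu) (h.pearson u hu y (h.carrier_subset hy))

theorem IsSemiClassical.isPolynomialOn_Pprev_P (h : 𝒟.IsSemiClassical J Ω N) (hu : u ∈ J)
    (n k : ℕ) :
    IsPolynomialOn (𝒟.regularPoints u) fun x =>
      𝒟.Rplus x u * 𝒟.Pprev n x (𝒟.ι.plus u) * 𝒟.Q k x (𝒟.ι.minus u) -
        𝒟.Rminus x u * 𝒟.P k x (𝒟.ι.minus u) * 𝒟.Qprev n x (𝒟.ι.plus u) := by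
  cases n with
  | succ n => exact h.isPolynomialOn_P_P hu n k
  -- As $p_{-1}=0$, only the term with the constant $q_{-1}$ survives, and no cancellation is
  -- needed.
  | zero =>
    obtain ⟨A, hA⟩ := 𝒟.isPolynomialOn_Rminus u (𝒟.regularPoints u)
    refine ⟨-(A * 𝒟.p k (𝒟.ι.minus u) *
      C (1 / (𝒟.a₀ (𝒟.ι.plus u) * 𝒟.γ 0 (𝒟.ι.plus u)))), fun x hx => ?_⟩
    simp only [Pprev, Qprev, P, eval_neg, eval_mul, eval_C, ← hA x hx]
    ring

theorem IsSemiClassical.isPolynomialOn_P_Pprev (h : 𝒟.IsSemiClassical J Ω N) (hu : u ∈ J)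
    (m n : ℕ) :
    IsPolynomialOn (𝒟.regularPoints u) fun x =>
      𝒟.Rplus x u * 𝒟.P m x (𝒟.ι.plus u) * 𝒟.Qprev n x (𝒟.ι.minus u) -
        𝒟.Rminus x u * 𝒟.Pprev n x (𝒟.ι.minus u) * 𝒟.Q m x (𝒟.ι.plus u) := by
  cases n with
  | succ n => exact h.isPolynomialOn_P_P hu m n
  | zero =>
    obtain ⟨A, hA⟩ := 𝒟.isPolynomialOn_Rplus u (𝒟.regularPoints u)
    refine ⟨A * 𝒟.p m (𝒟.ι.plus u) *
      C (1 / (𝒟.a₀ (𝒟.ι.minus u) * 𝒟.γ 0 (𝒟.ι.minus u))), fun x hx => ?_⟩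
    simp only [Pprev, Qprev, P, eval_mul, eval_C, ← hA x hx]
    ring

theorem IsSemiClassical.isPolynomialOn_Pprev_Pprev (h : 𝒟.IsSemiClassical J Ω N) (hu : u ∈ J)
    (n : ℕ) :
    IsPolynomialOn (𝒟.regularPoints u) fun x =>
      𝒟.Rplus x u * 𝒟.Pprev n x (𝒟.ι.plus u) * 𝒟.Qprev n x (𝒟.ι.minus u) -
        𝒟.Rminus x u * 𝒟.Pprev n x (𝒟.ι.minus u) * 𝒟.Qprev n x (𝒟.ι.plus u) := by
  cases n with
  | succ n => exact h.isPolynomialOn_P_P hu n n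
  | zero => exact ⟨0, fun x _ => by simp [Pprev]⟩

theorem IsSemiClassical.isPolynomialOn_coeffR (h : 𝒟.IsSemiClassical J Ω N) (hu : u ∈ J)
    (n : ℕ) : IsPolynomialOn (𝒟.regularPoints u) fun x => 𝒟.coeffR n x u := by
  refine (((((𝒟.isPolynomialOn_Rplus u _).const_mul (-(1 / 𝒟.a n (𝒟.ι.minus u)))).add
    ((𝒟.isPolynomialOn_Rminus u _).const_mul (-(1 / 𝒟.a n (𝒟.ι.plus u))))).add
    ((h.isPolynomialOn_Pprev_P hu n n).add
      ((h.isPolynomialOn_P_Pprev hu n n).const_mul (-1)))).const_mul (𝒟.H n u / 2)).congr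
    fun x _ => ?_
  simp only [coeffR]
  ring

theorem IsSemiClassical.isPolynomialOn_coeffΓ (h : 𝒟.IsSemiClassical J Ω N) (hu : u ∈ J)
    (n : ℕ) : IsPolynomialOn (𝒟.regularPoints u) fun x => 𝒟.coeffΓ n x u := by
  refine (((((𝒟.isPolynomialOn_Rplus u _).const_mul (1 / 𝒟.a n (𝒟.ι.minus u))).add
    ((𝒟.isPolynomialOn_Rminus u _).const_mul (-(1 / 𝒟.a n (𝒟.ι.plus u))))).add
    (((h.isPolynomialOn_Pprev_P hu n n).add
      (h.isPolynomialOn_P_Pprev hu n n)).const_mul (-1))).const_mul (𝒟.H n u / 𝒟.Δv u)).congr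
    fun x _ => ?_
  simp only [coeffΓ]
  ring

theorem IsSemiClassical.isPolynomialOn_coeffΞ (h : 𝒟.IsSemiClassical J Ω N) (hu : u ∈ J)
    (n : ℕ) : IsPolynomialOn (𝒟.regularPoints u) fun x => 𝒟.coeffΞ n x u := by
  refine (((((𝒟.isPolynomialOn_Rplus u _).const_mul (1 / 𝒟.a n (𝒟.ι.minus u))).add
    ((𝒟.isPolynomialOn_Rminus u _).const_mul (-(1 / 𝒟.a n (𝒟.ι.plus u))))).add
    ((h.isPolynomialOn_Pprev_P hu n n).add
      (h.isPolynomialOn_P_Pprev hu n n))).const_mul (𝒟.H n u / 𝒟.Δv u)).congr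
    fun x _ => ?_
  simp only [coeffΞ]
  ring

theorem IsSemiClassical.isPolynomialOn_coeffΦ (h : 𝒟.IsSemiClassical J Ω N) (hu : u ∈ J)
    (n : ℕ) : IsPolynomialOn (𝒟.regularPoints u) fun x => 𝒟.coeffΦ n x u :=
  (h.isPolynomialOn_P_P hu n n).const_mul (2 * 𝒟.H n u / 𝒟.Δv u)

theorem IsSemiClassical.isPolynomialOn_coeffΨ (h : 𝒟.IsSemiClassical J Ω N) (hu : u ∈ J)
    (n : ℕ) : IsPolynomialOn (𝒟.regularPoints u) fun x => 𝒟.coeffΨ n x u := by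
  refine ((h.isPolynomialOn_Pprev_Pprev hu n).const_mul (-(2 * 𝒟.H n u / 𝒟.Δv u))).congr
    fun x _ => ?_
  simp only [coeffΨ]
  ring

theorem IsSemiClassical.coeffR_smul_DD_Y (h : 𝒟.IsSemiClassical J Ω N) (hu : u ∈ J) {n : ℕ}
    (hn : (n : ℕ∞) ≤ N) {x : ℂ} (hx : x ∈ 𝒟.regularPoints u) (hxΩ : x ∈ Ω)
    (hwp : 𝒟.w x (𝒟.ι.plus u) ≠ 0) (hwm : 𝒟.w x (𝒟.ι.minus u) ≠ 0) :
    𝒟.coeffR n x u • 𝒟.ι.DD (𝒟.Y n x) u = 𝒟.numB n x u * 𝒟.ι.MM (𝒟.Y n x) u := by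
  obtain ⟨hxG, hcp, hcm⟩ := hx
  have hΔ := h.Δv_ne u hu
  have hΔv : 𝒟.ι.plus u - 𝒟.ι.minus u = 𝒟.Δv u := rfl
  have hap := 𝒟.one_div_a (h.ops_plus u hu) hn hxG hcp
  have ham := 𝒟.one_div_a (h.ops_minus u hu) hn hxG hcm
  -- Parametrizing by `t` builds the relation between the weights into the formulas; with each
  -- $1/a_n$ replaced by its Casoratian, every matrix entry becomes an identity of rational
  -- expressions.
  obtain ⟨t, htp, htm⟩ : ∃ t, 𝒟.Rplus x u = t * 𝒟.w x (𝒟.ι.plus u) ∧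
      𝒟.Rminus x u = t * 𝒟.w x (𝒟.ι.minus u) := by
    refine ⟨𝒟.Rplus x u / 𝒟.w x (𝒟.ι.plus u), (div_mul_cancel₀ _ hwp).symm, ?_⟩
    rw [div_mul_eq_mul_div, eq_div_iff hwp]
    exact (𝒟.Rplus_mul_eq hΔ (h.pearson u hu x hxΩ)).symm
  simp only [Conic.Shifts.DD, Conic.Shifts.MM, hΔv, Y, numB, coeffR, coeffΓ, coeffΞ, coeffΦ,
    coeffΨ, hap, ham, htp, htm]
  ext i j
  fin_cases i <;> fin_cases j <;>
    simp [Matrix.mul_apply, Fin.sum_univ_two] <;> field_simp <;> ring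

end Deformation

end SNUL

theorem mainTheorem7 (𝒟 : SNUL.Deformation) (J Ω : Set ℂ) (N : ℕ∞)
    (h : 𝒟.IsSemiClassical J Ω N) (u : ℂ) (hu : u ∈ J) (n : ℕ) (hn : (n : ℕ∞) ≤ N) :
    (SNUL.IsPolynomialOn (𝒟.regularPoints u) (fun x => 𝒟.coeffR n x u) ∧
      SNUL.IsPolynomialOn (𝒟.regularPoints u) (fun x => 𝒟.coeffΓ n x u) ∧
      SNUL.IsPolynomialOn (𝒟.regularPoints u) (fun x => 𝒟.coeffΞ n x u) ∧
      SNUL.IsPolynomialOn (𝒟.regularPoints u) (fun x => 𝒟.coeffΦ n x u) ∧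
      SNUL.IsPolynomialOn (𝒟.regularPoints u) (fun x => 𝒟.coeffΨ n x u)) ∧
    ∀ x ∈ 𝒟.regularPoints u, x ∈ Ω →
      𝒟.w x (𝒟.ι.plus u) ≠ 0 → 𝒟.w x (𝒟.ι.minus u) ≠ 0 →
        𝒟.coeffR n x u • 𝒟.ι.DD (𝒟.Y n x) u = 𝒟.numB n x u * 𝒟.ι.MM (𝒟.Y n x) u ∧
        (𝒟.coeffR n x u ≠ 0 →
          𝒟.ι.DD (𝒟.Y n x) u = 𝒟.B n x u * 𝒟.ι.MM (𝒟.Y n x) u) := by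
  refine ⟨⟨h.isPolynomialOn_coeffR hu n, h.isPolynomialOn_coeffΓ hu n,
    h.isPolynomialOn_coeffΞ hu n, h.isPolynomialOn_coeffΦ hu n, h.isPolynomialOn_coeffΨ hu n⟩,
    fun x hx hxΩ hwp hwm => ?_⟩
  have key := h.coeffR_smul_DD_Y hu hn hx hxΩ hwp hwm
  refine ⟨key, fun hR => ?_⟩
  rw [SNUL.Deformation.B, Matrix.smul_mul, ← key, smul_smul, inv_mul_cancel₀ hR, one_smul]
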